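/- Define the integers $v_0(N)$, $N\ge 0$, by the identity of formal power series $$\sum_{N=0}^\infty v_0(N)q^N=\sum_{n=0}^\infty \frac{q^{n^2}(-q;q^2)_n}{(q;q^2)_n},\qquad (a;q)_n=\prod_{i=1}^n\left(1-aq^{i-1}\right),\quad (a;q)_0=1$$ (so that $\sum_{N\ge 0} v_0(N)q^N=\tfrac12\,(V_0(q)+1)$, where $V_0(q)$ is the eighth order mock theta function of Gordon and McIntosh). **Theorem.** Let $n\ge 0$ be an integer that is not a triangular number, i.e. $n\neq k(k+1)/2$ for every integer $k\ge 0$ (in particular $0$ counts as triangular). Then for all integers $\alpha\ge 0$, $\beta\ge 0$ and every prime $p\ge 3$, $$v_0\left(2^{2\alpha+2}\,p^{2\beta}\,(8n+1)\right)\equiv 0 \pmod{2^{3\alpha+9}}.$$ -/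

import Mathlib

open PowerSeries

/-- The finite `q`-Pochhammer symbol `(a; q)_n = ∏_{i=1}^n (1 - a q^{i-1})`,
for formal power series `a`, `q` with integer coefficients. -/
noncomputable def qPoch (a q : ℤ⟦X⟧) (n : ℕ) : ℤ⟦X⟧ :=
  ∏ i ∈ Finset.range n, (1 - a * q ^ i)

/-- The `n`-th term `q^{n^2} (-q; q^2)_n / (q; q^2)_n` of the series for `(V_0(q) + 1) / 2`, as a
formal power series in `q = X`. The denominator has constant coefficient `1`, so `invOfUnit _ 1`
is its multiplicative inverse (see `qPoch_mul_invOfUnit`). -/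
noncomputable def V0Term (n : ℕ) : ℤ⟦X⟧ :=
  X ^ (n ^ 2) * qPoch (-X) (X ^ 2) n * invOfUnit (qPoch X (X ^ 2) n) 1

/-- `v_0(N)`: the coefficient of `q^N` in `∑_{n ≥ 0} q^{n^2} (-q; q^2)_n / (q; q^2)_n`.
The terms with `n > N` contribute nothing (see `coeff_sum_V0Term`). -/
noncomputable def v0 (N : ℕ) : ℤ :=
  coeff N (∑ n ∈ Finset.range (N + 1), V0Term n)

theorem constantCoeff_qPoch (n : ℕ) : constantCoeff (qPoch X (X ^ 2) n) = 1 := by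
  simp [qPoch, map_prod]

theorem qPoch_mul_invOfUnit (n : ℕ) :
    qPoch X (X ^ 2) n * invOfUnit (qPoch X (X ^ 2) n) 1 = 1 :=
  mul_invOfUnit _ _ (by simp [constantCoeff_qPoch])

theorem coeff_V0Term_of_lt {N n : ℕ} (h : N < n) : coeff N (V0Term n) = 0 := by
  have h2 : N < n ^ 2 := by nlinarith
  rw [V0Term, mul_assoc, coeff_X_pow_mul', if_neg (by omega)]

/-- The coefficient of `q^N` in every partial sum with more than `N` terms is `v_0(N)`. -/
theorem coeff_sum_V0Term {N M : ℕ} (h : N < M) :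
    coeff N (∑ n ∈ Finset.range M, V0Term n) = v0 N := by
  rw [v0, map_sum, map_sum]
  symm
  apply Finset.sum_subset
  · intro n hn
    simp only [Finset.mem_range] at *
    omega
  · intro n _ hn
    simp only [Finset.mem_range] at *
    exact coeff_V0Term_of_lt (by omega)

open scoped PowerSeries.WithPiTopology

/-! Write φ(q) = ∑_{n ∈ ℤ} q^{n²} (`theta 1`, with `theta (-1)` = φ(-q)), ψ(q) = ∑_{k ≥ 0}
q^{k(k+1)/2}, and D_ε(n) = `eulerSum ε n`. The proof has an analytic half and a 2-adic half.

Analytic half. D_ε satisfies a first-order recurrence in n, so D_1(n) D_{-1}(-n) is a constant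
multiple of the n-th term of the series for v_0 when n ≥ 0, and of the same term at -q when n < 0.
Summing over n ∈ ℤ and rearranging the triple series (`hasSum_eulerSum_mul`) evaluates the even part
of ∑ v_0(N) q^N. The companion sum with signs (-1)^n relates D_1(0) to D_{-1}(0), so the D's cancel.
One further bisection, by r_2(2n) = r_2(n), leaves (2 ∑ v_0(4n) q^n - 1) φ(-q) = φ(q)²
(`v0_four_mul_mul_theta`).

2-adic half. Put x = φ(q)⁴/φ(-q)⁴ = 1 + 16t and y = 2qψ(q⁸)/φ(q⁴). Then φ(±q) = φ(q⁴)(1 ± y) and y⁴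
= 1 - 1/x(q⁴), so everything is a polynomial of degree < 4 in y over ℤ[x, x⁻¹] taken at q⁴.
Extracting exponents divisible by 4 sends φ·t·g to 8·φ·t·g' with g, g' ∈ ℤ[x, x⁻¹]
(`exists_dissection`), and fixes φ. This yields the factor 2³ for each step in α
(`exists_v0_pow_four_mul`).

At the last step the exponent 8n+1 = 4(2n)+1 selects a component ψ(q²)·a with a ∈ ℤ[x, x⁻¹]. Such an
a is a constant, plus 16 times an odd series, plus a multiple of 128 (`ratioRing_le_nearConst`). At
q^{2n} the constant contributes a multiple of the n-th coefficient of ψ, which is 0 for n not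
triangular, and the odd series contributes nothing; a factor 2⁷ remains (`dvd_coeff_psi_mul`). -/

theorem summable_of_X_pow_dvd {ι : Type*} {f : ι → ℤ⟦X⟧} (g : ι → ℕ)
    (hg : ∀ d, {i | g i ≤ d}.Finite) (h : ∀ i, X ^ g i ∣ f i) : Summable f := by
  rw [PowerSeries.WithPiTopology.summable_iff_summable_coeff]
  intro d
  apply summable_of_hasFiniteSupport
  refine (hg d).subset fun i hi => ?_
  by_contra hlt
  exact hi (X_pow_dvd_iff.1 (h i) d (by simpa using hlt))

theorem coeff_tsum {ι : Type*} {f : ι → ℤ⟦X⟧} (hf : Summable f) (d : ℕ) :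
    coeff d (∑' i, f i) = ∑' i, coeff d (f i) :=
  ((PowerSeries.WithPiTopology.hasSum_iff_hasSum_coeff ℤ |>.1 hf.hasSum) d).tsum_eq.symm

/-! ### Euler-type sums D_ε(n) and their recurrence in n -/

/-- `1 / (q²; q²)_s`. -/
noncomputable def invPoch (s : ℕ) : ℤ⟦X⟧ :=
  invOfUnit (∏ i ∈ Finset.range s, (1 - X ^ (2 * (i + 1)))) 1

theorem prod_mul_invPoch (s : ℕ) :
    (∏ i ∈ Finset.range s, (1 - X ^ (2 * (i + 1)) : ℤ⟦X⟧)) * invPoch s = 1 :=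
  mul_invOfUnit _ _ (by simp [map_prod])

theorem invPoch_zero : invPoch 0 = 1 := by
  simpa using prod_mul_invPoch 0

theorem one_sub_mul_invPoch_succ (s : ℕ) :
    (1 - X ^ (2 * (s + 1))) * invPoch (s + 1) = invPoch s := by
  have h1 := prod_mul_invPoch s
  have h2 := prod_mul_invPoch (s + 1)
  rw [Finset.prod_range_succ] at h2
  linear_combination invPoch s * h2 - (1 - X ^ (2 * (s + 1))) * invPoch (s + 1) * h1

theorem finite_natAbs_le (d : ℕ) : {n : ℤ | n.natAbs ≤ d}.Finite :=
  (Set.finite_Icc (-(d : ℤ)) d).subset fun n hn => by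
    simp only [Set.mem_ofPred_eq, Set.mem_Icc] at *; omega

/-- A sign, as a constant power series. -/
noncomputable def sgn : ℤˣ →* ℤ⟦X⟧ :=
  (Int.castRingHom ℤ⟦X⟧ : ℤ →* ℤ⟦X⟧).comp (Units.coeHom ℤ)

/-- The series `∑_s ε^s q^{(n-s)²} / (q²; q²)_s`. -/
noncomputable def eulerSum (ε : ℤˣ) (n : ℤ) : ℤ⟦X⟧ :=
  ∑' s : ℕ, sgn (ε ^ s) * X ^ ((n - s).natAbs ^ 2) * invPoch s

theorem summable_eulerSum (ε : ℤˣ) (n : ℤ) :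
    Summable fun s : ℕ => sgn (ε ^ s) * X ^ ((n - s).natAbs ^ 2) * invPoch s := by
  apply summable_of_X_pow_dvd fun s : ℕ => (n - s).natAbs ^ 2
  · intro d
    refine (Set.finite_Iic (n.natAbs + d)).subset fun s hs => ?_
    simp only [Set.mem_ofPred_eq, Set.mem_Iic] at *
    have : (n - s).natAbs ≤ d := le_trans (Nat.le_self_pow (by norm_num) _) hs
    omega
  · intro s
    exact Dvd.intro_left _ rfl |>.mul_right _

/-- This is D_ε(n) = (ε + q^{2n-1}) D_ε(n-1), obtained by splitting off s = 0 and using (1 -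
q^{2(s+1)})/(q²;q²)_{s+1} = 1/(q²;q²)_s. The exponents a, b clear the possibly negative power
q^{2n-1}, so both signs of n are covered. -/
theorem eulerSum_shift (ε : ℤˣ) (n : ℤ) (a b : ℕ) (hab : (b : ℤ) = a + (2 * n - 1)) :
    X ^ a * (eulerSum ε n - sgn ε * eulerSum ε (n - 1)) = X ^ b * eulerSum ε (n - 1) := by
  have h1 : eulerSum ε n = X ^ (n.natAbs ^ 2) + ∑' s : ℕ,
      sgn (ε ^ (s + 1)) * X ^ ((n - 1 - s).natAbs ^ 2) * invPoch (s + 1) := by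
    rw [eulerSum, (summable_eulerSum ε n).tsum_eq_zero_add]
    simp only [invPoch_zero, Nat.cast_add, Nat.cast_one, sub_add_eq_sub_sub, sub_right_comm]
    simp
  have hs : Summable fun s : ℕ =>
      sgn (ε ^ (s + 1)) * X ^ ((n - 1 - s).natAbs ^ 2) * invPoch (s + 1) := by
    have := (summable_nat_add_iff 1).2 (summable_eulerSum ε n)
    simpa [sub_add_eq_sub_sub, sub_right_comm] using this
  have hb : X ^ b * eulerSum ε (n - 1) = X ^ a * X ^ (n.natAbs ^ 2) + ∑' s : ℕ,
      X ^ b * (sgn (ε ^ (s + 1)) * X ^ ((n - 1 - (s + 1 : ℕ)).natAbs ^ 2)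
        * invPoch (s + 1)) := by
    rw [eulerSum, ← (summable_eulerSum ε (n - 1)).tsum_mul_left,
      ((summable_eulerSum ε (n - 1)).mul_left _).tsum_eq_zero_add, invPoch_zero, ← pow_add]
    simp only [pow_zero, map_one, one_mul, mul_one, ← pow_add]
    congr 2
    zify
    simp only [sq_abs]
    linear_combination hab
  have hs2 := (summable_nat_add_iff 1).2 ((summable_eulerSum ε (n - 1)).mul_left (X ^ b))
  rw [hb, h1, mul_sub, mul_add, add_sub_assoc, eulerSum, ← hs.tsum_mul_left,
    ← (summable_eulerSum ε (n - 1)).tsum_mul_left,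
    ← (summable_eulerSum ε (n - 1)).mul_left _ |>.tsum_mul_left,
    ← (hs.mul_left _).tsum_sub (((summable_eulerSum ε (n - 1)).mul_left _).mul_left _)]
  congr 2
  funext s
  rw [← one_sub_mul_invPoch_succ s]
  have e : (X : ℤ⟦X⟧) ^ b * X ^ ((n - 1 - (s + 1 : ℕ)).natAbs ^ 2)
      = X ^ a * X ^ ((n - 1 - s).natAbs ^ 2) * X ^ (2 * (s + 1)) := by
    rw [← pow_add, ← pow_add, ← pow_add]
    congr 1
    zify
    simp only [sq_abs]
    linear_combination hab
  simp only [pow_succ ε, map_mul]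
  linear_combination (-(sgn (ε ^ s) * sgn ε) * invPoch (s + 1)) * e

theorem eulerSum_succ (ε : ℤˣ) (n : ℕ) :
    eulerSum ε (n + 1 : ℕ) = (sgn ε + X ^ (2 * n + 1)) * eulerSum ε n := by
  have := eulerSum_shift ε (n + 1 : ℕ) 0 (2 * n + 1) (by push_cast; ring)
  rw [show ((n + 1 : ℕ) : ℤ) - 1 = n by simp] at this
  linear_combination this

theorem eulerSum_neg_succ (ε : ℤˣ) (n : ℕ) :
    (1 + sgn ε * X ^ (2 * n + 1)) * eulerSum ε (-(n + 1 : ℕ))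
      = X ^ (2 * n + 1) * eulerSum ε (-n) := by
  have := eulerSum_shift ε (-n) (2 * n + 1) 0 (by push_cast; ring)
  rw [show -(n : ℤ) - 1 = -(n + 1 : ℕ) by push_cast; ring] at this
  linear_combination -this

theorem sgn_neg_one : sgn (-1) = -1 := by simp [sgn]

theorem qPoch_succ (a q : ℤ⟦X⟧) (n : ℕ) : qPoch a q (n + 1) = qPoch a q n * (1 - a * q ^ n) :=
  Finset.prod_range_succ _ _

theorem V0Term_succ (n : ℕ) :
    (1 - X ^ (2 * n + 1)) * V0Term (n + 1) = X ^ (2 * n + 1) * (1 + X ^ (2 * n + 1)) * V0Term n := by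
  have h1 := qPoch_mul_invOfUnit n
  have h2 := qPoch_mul_invOfUnit (n + 1)
  unfold V0Term
  set u := invOfUnit (qPoch X (X ^ 2) n) 1
  set v := invOfUnit (qPoch X (X ^ 2) (n + 1)) 1
  rw [qPoch_succ] at h2
  rw [qPoch_succ (-X)]
  have e : (X : ℤ⟦X⟧) ^ ((n + 1) ^ 2) = X ^ (n ^ 2) * X ^ (2 * n + 1) := by ring
  have e2 : (X : ℤ⟦X⟧) * (X ^ 2) ^ n = X ^ (2 * n + 1) := by ring
  rw [e2] at h2
  rw [e, neg_mul, e2]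
  linear_combination X ^ (n ^ 2) * X ^ (2 * n + 1) * qPoch (-X) (X ^ 2) n *
    (1 + X ^ (2 * n + 1)) * (u * h2 - (1 - X ^ (2 * n + 1)) * v * h1)

theorem V0Term_zero : V0Term 0 = 1 := by
  have := qPoch_mul_invOfUnit 0
  simp only [qPoch, Finset.range_zero, Finset.prod_empty, one_mul] at this
  simp [V0Term, qPoch, this]

theorem one_add_X_mul_ne_zero (a : ℤ⟦X⟧) (n : ℕ) : 1 + a * X ^ (2 * n + 1) ≠ 0 := by
  intro h
  have := congrArg constantCoeff h
  simp at this

/-- Both sides obey the same first-order recurrence: going up in n brings 1 + q^{2n+1} from the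
first factor, and q^{2n+1}/(1 - q^{2n+1}) from the second. Exchanging the two signs replaces q by
-q, which supplies the negative half of the bilateral series. -/
theorem eulerSum_mul_eulerSum_neg (n : ℕ) :
    eulerSum 1 n * eulerSum (-1) (-n) = eulerSum 1 0 * eulerSum (-1) 0 * V0Term n := by
  induction n with
  | zero => simp [V0Term_zero]
  | succ n ih =>
    have h1 := eulerSum_succ 1 n
    have h2 := eulerSum_neg_succ (-1) n
    have h3 := V0Term_succ n
    rw [sgn_neg_one] at h2
    rw [map_one] at h1
    apply mul_left_cancel₀ (one_add_X_mul_ne_zero (-1) n)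
    rw [h1]
    linear_combination (1 + X ^ (2 * n + 1)) * eulerSum 1 n * h2
      + X ^ (2 * n + 1) * (1 + X ^ (2 * n + 1)) * ih - eulerSum 1 0 * eulerSum (-1) 0 * h3

theorem eulerSum_neg_mul_eulerSum (n : ℕ) :
    eulerSum 1 (-n) * eulerSum (-1) n =
      eulerSum 1 0 * eulerSum (-1) 0 * rescale (-1) (V0Term n) := by
  induction n with
  | zero => simp [V0Term_zero]
  | succ n ih =>
    have h1 := eulerSum_succ (-1) n
    have h2 := eulerSum_neg_succ 1 n
    have h3 := congrArg (rescale (-1)) (V0Term_succ n)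
    simp only [map_mul, map_sub, map_add, map_one, map_pow, rescale_neg_one_X,
      Odd.neg_pow (odd_two_mul_add_one n)] at h3
    rw [sgn_neg_one] at h1
    rw [map_one] at h2
    apply mul_left_cancel₀ (one_add_X_mul_ne_zero 1 n)
    rw [h1]
    linear_combination (-1 + X ^ (2 * n + 1)) * eulerSum (-1) n * h2
      + X ^ (2 * n + 1) * (-1 + X ^ (2 * n + 1)) * ih - eulerSum 1 0 * eulerSum (-1) 0 * h3

theorem eulerSum_mul_eulerSum_neg_self (n : ℕ) :
    eulerSum 1 n * eulerSum 1 (-n) = eulerSum 1 0 ^ 2 * X ^ (n ^ 2) := by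
  induction n with
  | zero => simp [sq]
  | succ n ih =>
    have h1 := eulerSum_succ 1 n
    have h2 := eulerSum_neg_succ 1 n
    rw [map_one] at h1 h2
    rw [h1, show (n + 1) ^ 2 = (2 * n + 1) + n ^ 2 by ring, pow_add X]
    linear_combination eulerSum 1 n * h2 + X ^ (2 * n + 1) * ih

/-! ### Alternating convolutions of 1/(q²;q²)_s -/

/-- The generating function of the `1 / (q²; q²)_s`. -/
theorem rescale_mk_invPoch :
    rescale (X ^ 2 : ℤ⟦X⟧) (mk invPoch) = (1 - X) * mk invPoch := by
  ext1 n
  rcases n with _ | n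
  · simp [invPoch_zero]
  · rw [sub_mul, one_mul, map_sub, coeff_succ_X_mul]
    simp only [coeff_rescale, coeff_mk]
    linear_combination -one_sub_mul_invPoch_succ n

theorem expand_invPoch_succ (s : ℕ) :
    (1 - X ^ (2 * (2 * s + 2))) * expand 2 two_ne_zero (invPoch (s + 1))
      = expand 2 two_ne_zero (invPoch s) := by
  rw [← one_sub_mul_invPoch_succ s]
  simp only [map_mul, map_sub, map_one, map_pow, expand_X]
  ring

/-- With G(z) = ∑ z^s/(q²;q²)_s one has G(q²z) = (1-z) G(z), so F(z) = G(z)G(-z) satisfies F(q²z) =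
(1-z²) F(z). Comparing coefficients of z^{N+2} gives the recurrence. -/
theorem sum_antidiagonal_invPoch_step (N : ℕ) :
    (1 - X ^ (2 * (N + 2))) * ∑ p ∈ Finset.HasAntidiagonal.antidiagonal (N + 2),
        (-1) ^ p.2 * (invPoch p.1 * invPoch p.2)
      = ∑ p ∈ Finset.HasAntidiagonal.antidiagonal N, (-1) ^ p.2 * (invPoch p.1 * invPoch p.2) := by
  have hco (N : ℕ) : ∑ p ∈ Finset.HasAntidiagonal.antidiagonal N, (-1) ^ p.2 * (invPoch p.1 * invPoch p.2)
      = coeff N (mk invPoch * rescale (-1 : ℤ⟦X⟧) (mk invPoch)) := by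
    rw [coeff_mul]
    refine Finset.sum_congr rfl fun p _ => ?_
    simp only [coeff_rescale, coeff_mk]
    ring
  have h1 := congrArg (rescale (-1 : ℤ⟦X⟧)) rescale_mk_invPoch
  rw [rescale_rescale, mul_comm, ← rescale_rescale, map_mul, map_sub, map_one,
    rescale_neg_one_X] at h1
  have h2 : rescale (X ^ 2 : ℤ⟦X⟧) (mk invPoch * rescale (-1 : ℤ⟦X⟧) (mk invPoch))
      = (1 - X ^ 2) * (mk invPoch * rescale (-1 : ℤ⟦X⟧) (mk invPoch)) := by
    rw [map_mul, h1, rescale_mk_invPoch]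
    ring
  have h3 := congrArg (coeff (N + 2)) h2
  rw [sub_mul, one_mul, map_sub, coeff_X_pow_mul, coeff_rescale] at h3
  rw [hco, hco]
  linear_combination -h3

theorem sum_antidiagonal_invPoch_even (k : ℕ) :
    ∑ p ∈ Finset.HasAntidiagonal.antidiagonal (2 * k), (-1) ^ p.2 * (invPoch p.1 * invPoch p.2)
      = expand 2 two_ne_zero (invPoch k) := by
  induction k with
  | zero => simp [invPoch_zero]
  | succ k ih =>
    have h := sum_antidiagonal_invPoch_step (2 * k)
    rw [ih, ← expand_invPoch_succ] at h
    refine mul_left_cancel₀ (fun h0 => ?_) h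
    have := congrArg constantCoeff h0
    simp at this

theorem sum_antidiagonal_invPoch_odd (k : ℕ) :
    ∑ p ∈ Finset.HasAntidiagonal.antidiagonal (2 * k + 1), (-1) ^ p.2 * (invPoch p.1 * invPoch p.2) = 0 := by
  induction k with
  | zero =>
    rw [Finset.Nat.sum_antidiagonal_eq_sum_range_succ_mk]
    simp [Finset.sum_range_succ, mul_comm]
  | succ k ih =>
    have h := sum_antidiagonal_invPoch_step (2 * k + 1)
    rw [ih] at h
    refine (mul_eq_zero.1 h).resolve_left fun h0 => ?_
    have := congrArg constantCoeff h0
    simp at this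

/-! ### Theta series and the bilateral summation formula -/

/-- The theta series `∑_{n ∈ ℤ} ε^n q^{n²}`. -/
noncomputable def theta (ε : ℤˣ) : ℤ⟦X⟧ := ∑' n : ℤ, sgn (ε ^ n) * X ^ (n.natAbs ^ 2)

theorem summable_theta (ε : ℤˣ) : Summable fun n : ℤ => sgn (ε ^ n) * X ^ (n.natAbs ^ 2) := by
  apply summable_of_X_pow_dvd fun n : ℤ => n.natAbs ^ 2
  · intro d
    exact (finite_natAbs_le d).subset fun n hn => le_trans (Nat.le_self_pow (by norm_num) _) hn
  · exact fun n => Dvd.intro_left _ rfl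

theorem expand_tsum {ι : Type*} {f : ι → ℤ⟦X⟧} (k : ℕ) (hk : k ≠ 0) (hf : Summable f) :
    HasSum (fun i => expand k hk (f i)) (expand k hk (∑' i, f i)) := by
  rw [PowerSeries.WithPiTopology.hasSum_iff_hasSum_coeff]
  have := (PowerSeries.WithPiTopology.hasSum_iff_hasSum_coeff ℤ).1 hf.hasSum
  intro d
  simp only [coeff_expand]
  split_ifs
  · exact this _
  · exact hasSum_zero

theorem rescale_tsum {ι : Type*} {f : ι → ℤ⟦X⟧} (a : ℤ) (hf : Summable f) :
    HasSum (fun i => rescale a (f i)) (rescale a (∑' i, f i)) := by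
  rw [PowerSeries.WithPiTopology.hasSum_iff_hasSum_coeff]
  have := (PowerSeries.WithPiTopology.hasSum_iff_hasSum_coeff ℤ).1 hf.hasSum
  intro d
  simp only [coeff_rescale]
  exact (this d).mul_left _

/-- Since r, s ≥ 0, the bounds |n - r| ≤ d and |n + s| ≤ d force r + s ≤ 2d, so only finitely many
triples contribute to each degree. This justifies the interchanges of summation below. -/
theorem summable_double (c : ℤ × ℕ × ℕ → ℤ⟦X⟧) :
    Summable fun x : ℤ × ℕ × ℕ =>
      c x * X ^ ((x.1 - x.2.1).natAbs ^ 2 + (-x.1 - x.2.2).natAbs ^ 2) := by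
  apply summable_of_X_pow_dvd
    fun x : ℤ × ℕ × ℕ => (x.1 - x.2.1).natAbs ^ 2 + (-x.1 - x.2.2).natAbs ^ 2
  · intro d
    refine ((Set.finite_Icc (-(3 * d : ℤ)) (3 * d)).prod
      ((Set.finite_Iic (2 * d)).prod (Set.finite_Iic (2 * d)))).subset fun x hx => ?_
    obtain ⟨n, r, s⟩ := x
    simp only [Set.mem_ofPred_eq, Set.mem_prod, Set.mem_Iic, Set.mem_Icc] at *
    have h1 : (n - r).natAbs ≤ d := by
      have := Nat.le_self_pow two_ne_zero (n - r).natAbs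
      omega
    have h2 : (-n - s).natAbs ≤ d := by
      have := Nat.le_self_pow two_ne_zero (-n - s).natAbs
      omega
    omega
  · exact fun n => Dvd.intro_left _ rfl

theorem summable_double_fiber (c : ℕ × ℕ → ℤ⟦X⟧) (n : ℤ) :
    Summable fun p : ℕ × ℕ => c p * X ^ ((n - p.1).natAbs ^ 2 + (-n - p.2).natAbs ^ 2) :=
  (summable_double fun x => c x.2).prod_factor n

theorem expand_sgn (k : ℕ) (hk : k ≠ 0) (u : ℤˣ) : expand k hk (sgn u) = sgn u := by
  rcases Int.units_eq_one_or u with rfl | rfl <;> simp [sgn]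

theorem expand_X_pow (k : ℕ) (hk : k ≠ 0) (n : ℕ) :
    expand k hk (X ^ n : ℤ⟦X⟧) = X ^ (k * n) := by
  rw [map_pow, expand_X, pow_mul]

theorem eulerSum_mul_eulerSum (ε : ℤˣ) (n : ℤ) :
    eulerSum 1 n * eulerSum ε (-n) = ∑' p : ℕ × ℕ, sgn (ε ^ p.2) * (invPoch p.1 * invPoch p.2)
      * X ^ ((n - p.1).natAbs ^ 2 + (-n - p.2).natAbs ^ 2) := by
  have e (p : ℕ × ℕ) : sgn (1 ^ p.1) * X ^ ((n - p.1).natAbs ^ 2) * invPoch p.1 *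
      (sgn (ε ^ p.2) * X ^ ((-n - p.2).natAbs ^ 2) * invPoch p.2) =
      sgn (ε ^ p.2) * (invPoch p.1 * invPoch p.2)
      * X ^ ((n - p.1).natAbs ^ 2 + (-n - p.2).natAbs ^ 2) := by
    rw [one_pow, map_one, pow_add]
    ring
  rw [eulerSum, eulerSum, Summable.tsum_mul_tsum (summable_eulerSum 1 n) (summable_eulerSum ε (-n))]
  · exact tsum_congr e
  · simp only [e]
    exact summable_double_fiber (fun p => sgn (ε ^ p.2) * (invPoch p.1 * invPoch p.2)) n

/-- Recentre at m = j + k: (j - k)² + (j + k)² = 2j² + 2k². -/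
theorem tsum_theta_shift_even (δ : ℤˣ) (k : ℕ) :
    ∑' m : ℤ, sgn (δ ^ m) * X ^ ((m - (2 * k : ℕ)).natAbs ^ 2 + m.natAbs ^ 2)
      = sgn (δ ^ k) * X ^ (2 * k ^ 2) * expand 2 two_ne_zero (theta δ) := by
  rw [← (Equiv.addRight (k : ℤ)).tsum_eq, theta,
    ← (expand_tsum 2 two_ne_zero (summable_theta δ)).tsum_eq,
    ← (expand_tsum 2 two_ne_zero (summable_theta δ)).summable.tsum_mul_left]
  refine tsum_congr fun j => ?_
  rw [map_mul, expand_sgn, expand_X_pow, Equiv.coe_addRight, zpow_add, map_mul, zpow_natCast]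
  have e : (j + k - (2 * k : ℕ)).natAbs ^ 2 + (j + k).natAbs ^ 2 = 2 * k ^ 2 + 2 * j.natAbs ^ 2 := by
    zify
    simp only [sq_abs]
    ring
  rw [e, pow_add]
  ring

theorem hasSum_sum_antidiagonal {F : ℕ × ℕ → ℤ⟦X⟧} (hF : Summable F) :
    HasSum (fun N => ∑ p ∈ Finset.HasAntidiagonal.antidiagonal N, F p) (∑' p, F p) := by
  have h := (Finset.HasAntidiagonal.sigmaAntidiagonalEquivProd (A := ℕ)).hasSum_iff.2 hF.hasSum
  refine h.sigma fun N => ?_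
  rw [← Finset.sum_coe_sort]
  exact hasSum_fintype _

/-- The summand of the triple series obtained from `∑ δ^n D_1(n) D_ε(-n)`, `δ ε = -1`, by the
shift `n = m - s`. -/
noncomputable def tripleTerm (δ : ℤˣ) (p : ℕ × ℕ) (m : ℤ) : ℤ⟦X⟧ :=
  (-1) ^ p.2 * (invPoch p.1 * invPoch p.2) *
    (sgn (δ ^ m) * X ^ ((m - (p.1 + p.2 : ℕ)).natAbs ^ 2 + m.natAbs ^ 2))

/-- The change of variables `(m, (r, s)) ↦ (m - s, (r, s))`. -/
def shiftEquiv : (ℕ × ℕ) × ℤ ≃ ℤ × ℕ × ℕ where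
  toFun x := (x.2 - x.1.2, x.1)
  invFun x := (x.2, x.1 + x.2.2)
  left_inv x := by simp
  right_inv x := by simp

/-- After n = m - s the quadratic exponent depends on (r, s) only through r + s, and δ^{m-s} ε^s =
(-1)^s δ^m. The (r, s)-sum thus becomes the alternating convolution evaluated above. -/
theorem tripleTerm_eq (δ ε : ℤˣ) (h : δ * ε = -1) (r s : ℕ) (m : ℤ) :
    tripleTerm δ (r, s) m = sgn (δ ^ (m - s)) * (sgn (ε ^ s) * (invPoch r * invPoch s)) *
      X ^ ((m - s - r).natAbs ^ 2 + (-(m - s) - s : ℤ).natAbs ^ 2) := by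
  have h3 : δ ^ (m - s : ℤ) * ε ^ s = (-1) ^ s * δ ^ m := by
    rw [← h, mul_pow, zpow_sub, zpow_natCast, Int.units_inv_eq_self, mul_assoc, mul_comm]
  have h4 : (m - s - r).natAbs = (m - (r + s : ℕ)).natAbs := by
    congr 1; push_cast; ring
  have h5 : (-(m - s) - s : ℤ).natAbs = m.natAbs := by
    rw [show -(m - s) - s = -m by ring, Int.natAbs_neg]
  have h6 := congrArg sgn h3
  rw [map_mul, map_mul, map_pow sgn (-1), sgn_neg_one] at h6
  rw [h4, h5, tripleTerm]
  linear_combination (- invPoch r * invPoch s *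
    X ^ ((m - (r + s : ℕ)).natAbs ^ 2 + m.natAbs ^ 2)) * h6

theorem hasSum_eulerSum_mul_aux (δ ε : ℤˣ) (h : δ * ε = -1) :
    Summable (fun x : (ℕ × ℕ) × ℤ => tripleTerm δ x.1 x.2) ∧
    HasSum (fun n : ℤ => sgn (δ ^ n) * (eulerSum 1 n * eulerSum ε (-n)))
      (∑' x : (ℕ × ℕ) × ℤ, tripleTerm δ x.1 x.2) := by
  have hS := summable_double fun x => sgn (δ ^ x.1) *
    (sgn (ε ^ x.2.2) * (invPoch x.2.1 * invPoch x.2.2))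
  have hS' := shiftEquiv.hasSum_iff.2 hS.hasSum
  have hT : HasSum (fun x : (ℕ × ℕ) × ℤ => tripleTerm δ x.1 x.2) _ :=
    hS'.congr_fun fun x => (tripleTerm_eq δ ε h x.1.1 x.1.2 x.2)
  refine ⟨hT.summable, ?_⟩
  rw [hT.tsum_eq]
  have := hS.hasSum.prod_fiberwise fun n => (hS.prod_factor n).hasSum
  convert this using 2 with n
  rw [eulerSum_mul_eulerSum, ← Summable.tsum_mul_left]
  · exact tsum_congr fun p => (mul_assoc _ _ _).symm
  · exact summable_double_fiber (fun p => sgn (ε ^ p.2) * (invPoch p.1 * invPoch p.2)) n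

theorem summable_theta_shift (δ : ℤˣ) (N : ℕ) : Summable fun m : ℤ =>
    sgn (δ ^ m) * X ^ ((m - N).natAbs ^ 2 + m.natAbs ^ 2) := by
  apply summable_of_X_pow_dvd fun m : ℤ => (m - N).natAbs ^ 2 + m.natAbs ^ 2
  · intro d
    refine (finite_natAbs_le d).subset fun n hn => ?_
    have := Nat.le_self_pow two_ne_zero n.natAbs
    simp only [Set.mem_ofPred_eq] at *
    omega
  · exact fun n => Dvd.intro_left _ rfl

/-- The theta series `∑_m δ^m q^{(m-N)²+m²}`. -/
noncomputable def thetaShift (δ : ℤˣ) (N : ℕ) : ℤ⟦X⟧ :=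
  ∑' m : ℤ, sgn (δ ^ m) * X ^ ((m - N).natAbs ^ 2 + m.natAbs ^ 2)

theorem tsum_tripleTerm (δ : ℤˣ) (p : ℕ × ℕ) : ∑' m : ℤ, tripleTerm δ p m =
    (-1) ^ p.2 * (invPoch p.1 * invPoch p.2) * thetaShift δ (p.1 + p.2) := by
  rw [thetaShift, ← (summable_theta_shift δ _).tsum_mul_left]
  rfl

theorem hasSum_tripleTerm (δ : ℤˣ)
    (hT : Summable (fun x : (ℕ × ℕ) × ℤ => tripleTerm δ x.1 x.2)) :
    HasSum (fun N => (∑ p ∈ Finset.HasAntidiagonal.antidiagonal N,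
      (-1) ^ p.2 * (invPoch p.1 * invPoch p.2)) * thetaShift δ N)
      (∑' x : (ℕ × ℕ) × ℤ, tripleTerm δ x.1 x.2) := by
  have hP := hT.prod
  rw [hT.tsum_prod]
  simp only [tsum_tripleTerm] at hP ⊢
  refine (hasSum_sum_antidiagonal hP).congr_fun fun N => ?_
  rw [Finset.sum_mul]
  refine Finset.sum_congr rfl fun c hc => ?_
  rw [Finset.HasAntidiagonal.mem_antidiagonal.1 hc]

theorem hasSum_tripleTerm_even (δ : ℤˣ) {a : ℤ⟦X⟧}
    (h : HasSum (fun N => (∑ p ∈ Finset.HasAntidiagonal.antidiagonal N,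
      (-1) ^ p.2 * (invPoch p.1 * invPoch p.2)) * thetaShift δ N) a) :
    HasSum (fun k => expand 2 two_ne_zero (invPoch k) * thetaShift δ (2 * k)) a := by
  have hinj : Function.Injective fun k : ℕ => 2 * k := fun a b hab => by
    simpa using hab
  refine (((hinj.hasSum_iff ?_).2 h).congr_fun fun k => ?_)
  · intro N hN
    obtain ⟨k, rfl⟩ : Odd N := by
      rw [← Nat.not_even_iff_odd]
      rintro ⟨k, rfl⟩
      exact hN ⟨k, two_mul k⟩
    rw [sum_antidiagonal_invPoch_odd, zero_mul]
  · rw [Function.comp, sum_antidiagonal_invPoch_even]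

theorem hasSum_expand_eulerSum_mul_theta (δ : ℤˣ) :
    HasSum (fun k => expand 2 two_ne_zero (invPoch k) * thetaShift δ (2 * k))
      (expand 2 two_ne_zero (eulerSum δ 0) * expand 2 two_ne_zero (theta δ)) := by
  have hE := (expand_tsum 2 two_ne_zero (summable_eulerSum δ 0)).mul_right
    (expand 2 two_ne_zero (theta δ))
  rw [← eulerSum] at hE
  refine hE.congr_fun fun k => ?_
  rw [thetaShift, tsum_theta_shift_even, map_mul, map_mul, expand_sgn, expand_X_pow, zero_sub,
    Int.natAbs_neg, Int.natAbs_natCast]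
  ring

/-- Summing over r + s = N first kills odd N; for N = 2k it gives 1/(q⁴;q⁴)_k, and the theta sum
over m separates. The case (δ, ε) = (1, -1) evaluates the even part of the v_0 series; (-1, 1)
relates D_1(0), D_{-1}(0) and φ(-q). -/
theorem hasSum_eulerSum_mul (δ ε : ℤˣ) (h : δ * ε = -1) :
    HasSum (fun n : ℤ => sgn (δ ^ n) * (eulerSum 1 n * eulerSum ε (-n)))
      (expand 2 two_ne_zero (eulerSum δ 0) * expand 2 two_ne_zero (theta δ)) := by
  obtain ⟨h1, h2⟩ := hasSum_eulerSum_mul_aux δ ε h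
  rwa [(hasSum_tripleTerm_even δ (hasSum_tripleTerm δ h1)).unique
    (hasSum_expand_eulerSum_mul_theta δ)] at h2

/-! ### Relations between D_1(0), D_{-1}(0) and the even part of the v_0 series -/

theorem X_pow_dvd_tsum {ι : Type*} {f : ι → ℤ⟦X⟧} (hf : Summable f) (d : ℕ)
    (h : ∀ i, X ^ d ∣ f i) : X ^ d ∣ ∑' i, f i := by
  rw [X_pow_dvd_iff]
  intro m hm
  rw [coeff_tsum hf]
  simp only [X_pow_dvd_iff.1 (h _) m hm, tsum_zero]

theorem exists_eulerSum_neg_eq (ε : ℤˣ) (k : ℕ) :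
    ∃ u, eulerSum ε (-k) = X ^ k ^ 2 * (1 + X ^ (2 * k + 1) * u) := by
  have hS := summable_eulerSum ε (-k)
  have h : X ^ (k ^ 2 + (2 * k + 1)) ∣ ∑' s : ℕ, sgn (ε ^ (s + 1)) *
      X ^ ((-k - (s + 1 : ℕ) : ℤ).natAbs ^ 2) * invPoch (s + 1) := by
    refine X_pow_dvd_tsum ((summable_nat_add_iff 1).2 hS) _ fun s => ?_
    refine ((pow_dvd_pow X ?_).mul_left _).mul_right _
    have : (-k - (s + 1 : ℕ) : ℤ).natAbs = k + s + 1 := by omega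
    rw [this]
    nlinarith
  obtain ⟨u, hu⟩ := h
  refine ⟨u, ?_⟩
  rw [eulerSum, hS.tsum_eq_zero_add, hu]
  simp [invPoch_zero]
  ring

theorem eulerSum_zero_ne_zero (ε : ℤˣ) : eulerSum ε 0 ≠ 0 := by
  obtain ⟨u, hu⟩ := exists_eulerSum_neg_eq ε 0
  intro h
  have := congrArg constantCoeff hu
  simp [h] at this

/-- The ratio D_1(-k) D_{-1}(-k) / D_{-1}(-k)(q²) does not depend on k, because (1 + q^{2k+1})(1 -
q^{2k+1}) = 1 - q^{2(2k+1)}. As k → ∞ numerator and denominator share the leading term q^{2k²}, so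
the ratio is 1. -/
theorem eulerSum_mul_eulerSum_eq_expand :
    eulerSum 1 0 * eulerSum (-1) 0 = expand 2 two_ne_zero (eulerSum (-1) 0) := by
  have hcross (k : ℕ) : eulerSum 1 0 * eulerSum (-1) 0 *
      expand 2 two_ne_zero (eulerSum (-1) (-k)) =
      expand 2 two_ne_zero (eulerSum (-1) 0) * (eulerSum 1 (-k) * eulerSum (-1) (-k)) := by
    induction k with
    | zero => simp [mul_comm]
    | succ k ih =>
      have h1 := eulerSum_neg_succ 1 k
      have h2 := eulerSum_neg_succ (-1) k
      have h3 := congrArg (expand 2 two_ne_zero) h2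
      simp only [map_mul, map_add, map_one, expand_sgn, expand_X_pow] at h1 h3
      rw [sgn_neg_one] at h2 h3
      have hne : (1 + -1 * X ^ (2 * (2 * k + 1)) : ℤ⟦X⟧) ≠ 0 := by
        intro h
        have := congrArg constantCoeff h
        simp at this
      apply mul_left_cancel₀ hne
      have e : (X : ℤ⟦X⟧) ^ (2 * (2 * k + 1)) = X ^ (2 * k + 1) * X ^ (2 * k + 1) := by ring
      rw [e] at h3 ⊢
      set y : ℤ⟦X⟧ := X ^ (2 * k + 1)
      linear_combination eulerSum 1 0 * eulerSum (-1) 0 * h3 + y * y * ih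
        - expand 2 two_ne_zero (eulerSum (-1) 0) * ((1 - y) * eulerSum (-1) (-(k + 1 : ℕ)) * h1
          + y * eulerSum 1 (-k) * h2)
  ext n
  -- Taking k = n suffices for the coefficient of q^n: the corrections to the leading terms are
  -- O(q^{2n+1}).
  obtain ⟨u, hu⟩ := exists_eulerSum_neg_eq 1 n
  obtain ⟨v, hv⟩ := exists_eulerSum_neg_eq (-1) n
  have h := hcross n
  rw [hv, hu] at h
  simp only [map_mul, map_add, map_one, expand_X_pow] at h
  have h2 : eulerSum 1 0 * eulerSum (-1) 0 *
      (1 + X ^ (2 * (2 * n + 1)) * expand 2 two_ne_zero v) =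
      expand 2 two_ne_zero (eulerSum (-1) 0) *
      ((1 + X ^ (2 * n + 1) * u) * (1 + X ^ (2 * n + 1) * v)) := by
    apply mul_left_cancel₀ (pow_ne_zero (2 * n ^ 2) (X_ne_zero (R := ℤ)))
    linear_combination h
  have hd : X ^ (2 * n + 1) ∣ eulerSum 1 0 * eulerSum (-1) 0 -
      expand 2 two_ne_zero (eulerSum (-1) 0) := by
    refine ⟨expand 2 two_ne_zero (eulerSum (-1) 0) * (u + v + X ^ (2 * n + 1) * u * v) -
      eulerSum 1 0 * eulerSum (-1) 0 * (X ^ (2 * n + 1) * expand 2 two_ne_zero v), ?_⟩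
    linear_combination h2
  have := X_pow_dvd_iff.1 hd n (by omega)
  rwa [map_sub, sub_eq_zero] at this

theorem hasSum_V0Term : HasSum V0Term (mk v0) := by
  rw [PowerSeries.WithPiTopology.hasSum_iff_hasSum_coeff]
  intro d
  rw [coeff_mk, v0, map_sum]
  refine hasSum_sum_of_ne_finset_zero fun n hn => ?_
  exact coeff_V0Term_of_lt (by simpa using hn)

/-- The bilateral sum splits into n ≥ 0 and n ≤ 0; the term n = 0 is then counted twice, whence the
-1. -/
theorem eulerSum_mul_even_part :
    eulerSum 1 0 * eulerSum (-1) 0 * (mk v0 + rescale (-1) (mk v0) - 1) =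
      expand 2 two_ne_zero (eulerSum 1 0) * expand 2 two_ne_zero (theta 1) := by
  have h := hasSum_eulerSum_mul 1 (-1) (one_mul _)
  simp only [one_zpow, map_one, one_mul] at h
  have h1 := hasSum_V0Term.mul_left (eulerSum 1 0 * eulerSum (-1) 0)
  have h2 := (rescale_tsum (-1) hasSum_V0Term.summable).mul_left (eulerSum 1 0 * eulerSum (-1) 0)
  rw [hasSum_V0Term.tsum_eq] at h2
  simp only [← eulerSum_mul_eulerSum_neg] at h1
  simp only [← eulerSum_neg_mul_eulerSum] at h2
  have h3 := HasSum.of_nat_of_neg (f := fun n : ℤ => eulerSum 1 n * eulerSum (-1) (-n)) h1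
    (by simpa only [neg_neg] using h2)
  rw [h.unique h3, neg_zero]
  ring

/-- Here D_1(n) D_1(-n) = D_1(0)² q^{n²}, so the bilateral sum with signs (-1)^n is itself a theta
series. -/
theorem eulerSum_sq_mul_theta :
    eulerSum 1 0 ^ 2 * theta (-1) =
      expand 2 two_ne_zero (eulerSum (-1) 0) * expand 2 two_ne_zero (theta (-1)) := by
  have h := hasSum_eulerSum_mul (-1) 1 (mul_one _)
  refine (h.unique ?_).symm
  refine ((summable_theta (-1)).hasSum.mul_left (eulerSum 1 0 ^ 2)).congr_fun fun n => ?_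
  have : eulerSum 1 n * eulerSum 1 (-n) = eulerSum 1 0 ^ 2 * X ^ (n.natAbs ^ 2) := by
    rw [← eulerSum_mul_eulerSum_neg_self]
    rcases Int.natAbs_eq n with h | h
    · rw [← h]
    · rw [h, Int.natAbs_neg, Int.natAbs_natCast, neg_neg, mul_comm]
  rw [this]
  ring

theorem eulerSum_mul_theta :
    eulerSum 1 0 * theta (-1) = eulerSum (-1) 0 * expand 2 two_ne_zero (theta (-1)) := by
  apply mul_left_cancel₀ (eulerSum_zero_ne_zero 1)
  have h := eulerSum_sq_mul_theta
  rw [← eulerSum_mul_eulerSum_eq_expand] at h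
  linear_combination h

theorem expand_injective (k : ℕ) (hk : k ≠ 0) : Function.Injective (expand (R := ℤ) k hk) := by
  intro f g h
  ext n
  rw [← coeff_expand_mul k hk f, h, coeff_expand_mul]

theorem eulerSum_mul_v0_even :
    eulerSum (-1) 0 * (mk (fun n => 2 * v0 (2 * n)) - 1) = eulerSum 1 0 * theta 1 := by
  apply expand_injective 2 two_ne_zero
  have h := eulerSum_mul_even_part
  rw [eulerSum_mul_eulerSum_eq_expand] at h
  rw [map_mul, map_mul, ← h, map_sub, map_one]
  congr 2
  ext n
  rw [map_add, coeff_rescale, coeff_mk, coeff_expand]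
  split_ifs with hn
  · obtain ⟨m, rfl⟩ := hn
    rw [Nat.mul_div_cancel_left m two_pos, coeff_mk, pow_mul]
    ring
  · rw [(Nat.not_even_iff_odd.1 (mt even_iff_two_dvd.1 hn)).neg_one_pow]
    ring

/-! ### Classical identities for φ and ψ -/

/-- The series `∑_{k ≥ 0} q^{k(k+1)/2}`. -/
noncomputable def psi : ℤ⟦X⟧ :=
  open scoped Classical in mk fun n => if ∃ k : ℕ, n = k * (k + 1) / 2 then 1 else 0

theorem exists_triangular_iff (n : ℕ) : (∃ k : ℕ, n = k * (k + 1) / 2) ↔ IsSquare (8 * n + 1) := by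
  constructor
  · rintro ⟨k, rfl⟩
    obtain ⟨t, ht⟩ := (Nat.even_mul_succ_self k).two_dvd
    refine ⟨2 * k + 1, ?_⟩
    rw [ht, Nat.mul_div_cancel_left t two_pos]
    linarith
  · rintro ⟨r, hr⟩
    obtain ⟨k, rfl | rfl⟩ := Nat.even_or_odd' r
    · have := congrArg (· % 2) hr
      have e : 2 * k * (2 * k) = 2 * (k * (2 * k)) := by ring
      omega
    · refine ⟨k, ?_⟩
      have : k * (k + 1) = 2 * n := by linarith
      omega

/-- The series `∑_{k ≥ 0} q^{k²}`. -/
noncomputable def squareSeries : ℤ⟦X⟧ :=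
  open scoped Classical in mk fun n => if IsSquare n then 1 else 0

theorem hasSum_squareSeries : HasSum (fun n : ℕ => (X : ℤ⟦X⟧) ^ n ^ 2) squareSeries := by
  classical
  rw [PowerSeries.WithPiTopology.hasSum_iff_hasSum_coeff]
  intro d
  rw [squareSeries, coeff_mk]
  simp only [coeff_X_pow]
  split_ifs with h
  · obtain ⟨r, rfl⟩ := h
    refine (hasSum_ite_eq r (1 : ℤ)).congr_fun fun n => ?_
    simp only [← sq, Nat.pow_left_inj two_ne_zero, @eq_comm _ r n]
  · refine hasSum_zero.congr_fun fun n => ?_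
    rw [if_neg]
    rintro rfl
    exact h ⟨n, sq n⟩

theorem theta_one_eq : theta 1 = 2 * squareSeries - 1 := by
  have h := HasSum.of_nat_of_neg (f := fun n : ℤ => sgn (1 ^ n) * X ^ (n.natAbs ^ 2))
    (by simpa using hasSum_squareSeries) (by simpa using hasSum_squareSeries)
  rw [theta, h.tsum_eq]
  simp
  ring

theorem rescale_theta : rescale (-1) (theta 1) = theta (-1) := by
  rw [theta, ← (rescale_tsum (-1) (summable_theta 1)).tsum_eq, theta]
  refine tsum_congr fun n => ?_
  rw [one_zpow, map_one, one_mul, map_pow, rescale_neg_one_X, neg_pow]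
  congr 1
  rcases Int.even_or_odd n with h | h
  · rw [h.neg_one_zpow, map_one, ((Int.natAbs_even.2 h).pow_of_ne_zero two_ne_zero).neg_one_pow]
  · rw [h.neg_one_zpow, sgn_neg_one, ((Int.natAbs_odd.2 h).pow).neg_one_pow]

/-- Even squares are 4 times squares, and odd squares are the numbers 8T + 1 with T triangular. -/
theorem squareSeries_eq : squareSeries = expand 4 four_ne_zero squareSeries +
    X * expand 8 (by norm_num) psi := by
  classical
  ext n
  rw [map_add, coeff_expand]
  have h4 : 4 ∣ n → (IsSquare n ↔ IsSquare (n / 4)) := by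
    rintro ⟨m, rfl⟩
    rw [Nat.mul_div_cancel_left m four_pos]
    constructor
    · rintro ⟨r, hr⟩
      obtain ⟨k, rfl⟩ : Even r := by
        by_contra h
        have := (Nat.not_even_iff_odd.1 h).mul (Nat.not_even_iff_odd.1 h)
        rw [← hr] at this
        exact Nat.not_even_iff_odd.2 this ⟨2 * m, by ring⟩
      exact ⟨k, by linarith⟩
    · rintro ⟨r, rfl⟩
      exact ⟨2 * r, by ring⟩
  have hsq : IsSquare n → n % 4 = 0 ∨ n % 8 = 1 := by
    rintro ⟨r, rfl⟩
    have hr : r % 8 < 8 := Nat.mod_lt _ (by norm_num)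
    rw [Nat.mul_mod r r 8, Nat.mul_mod r r 4,
      ← Nat.mod_mod_of_dvd r (show 4 ∣ 8 by norm_num)]
    interval_cases r % 8 <;> simp
  rcases n with _ | m
  · simp [squareSeries]
  · rw [coeff_succ_X_mul, coeff_expand]
    simp only [squareSeries, psi, coeff_mk, exists_triangular_iff]
    by_cases ha : 4 ∣ m + 1
    · rw [if_pos ha, if_neg (show ¬ 8 ∣ m by omega), add_zero]
      simp only [h4 ha]
    · rw [if_neg ha, zero_add]
      by_cases hb : 8 ∣ m
      · rw [if_pos hb, Nat.mul_div_cancel' hb]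
      · rw [if_neg hb, if_neg]
        intro h
        have := hsq h
        omega

theorem theta_eq : theta 1 = expand 4 four_ne_zero (theta 1) +
    2 * (X * expand 8 (by norm_num) psi) := by
  rw [theta_one_eq]
  simp only [map_sub, map_mul, map_one, map_ofNat]
  linear_combination 2 * squareSeries_eq

theorem theta_sq : theta 1 ^ 2 = ∑' p : ℤ × ℤ, X ^ (p.1.natAbs ^ 2 + p.2.natAbs ^ 2) ∧
    Summable fun p : ℤ × ℤ => (X : ℤ⟦X⟧) ^ (p.1.natAbs ^ 2 + p.2.natAbs ^ 2) := by
  have hS : Summable fun p : ℤ × ℤ => (X : ℤ⟦X⟧) ^ (p.1.natAbs ^ 2 + p.2.natAbs ^ 2) := by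
    apply summable_of_X_pow_dvd fun p : ℤ × ℤ => p.1.natAbs ^ 2 + p.2.natAbs ^ 2
    · intro d
      refine ((finite_natAbs_le d).prod (finite_natAbs_le d)).subset fun p hp => ?_
      have := Nat.le_self_pow two_ne_zero p.1.natAbs
      have := Nat.le_self_pow two_ne_zero p.2.natAbs
      simp only [Set.mem_ofPred_eq, Set.mem_prod] at *
      omega
    · exact fun _ => dvd_rfl
  refine ⟨?_, hS⟩
  have e (p : ℤ × ℤ) : sgn (1 ^ p.1) * X ^ (p.1.natAbs ^ 2) * (sgn (1 ^ p.2) * X ^ (p.2.natAbs ^ 2))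
      = X ^ (p.1.natAbs ^ 2 + p.2.natAbs ^ 2) := by
    simp [pow_add]
  rw [sq, theta, Summable.tsum_mul_tsum (summable_theta 1) (summable_theta 1)]
  · exact tsum_congr e
  · simpa only [e] using hS

/-- The map (a, b) ↦ (a + b, a - b) carries representations of n as a sum of two squares bijectively
to those of 2n; it is onto because the two entries in a representation of 2n have equal parity. -/
theorem coeff_two_mul_theta_sq (n : ℕ) : coeff (2 * n) (theta 1 ^ 2) = coeff n (theta 1 ^ 2) := by
  obtain ⟨h, hS⟩ := theta_sq
  rw [h, coeff_tsum hS, coeff_tsum hS]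
  simp only [coeff_X_pow]
  let i : ℤ × ℤ → ℤ × ℤ := fun p => (p.1 + p.2, p.1 - p.2)
  have hi : Function.Injective i := by
    rintro ⟨a, b⟩ ⟨c, d⟩ h
    simp only [i, Prod.mk.injEq] at h ⊢
    omega
  rw [← hi.tsum_eq]
  · refine tsum_congr fun p => ?_
    congr 1
    apply propext
    simp only [i]
    zify
    simp only [sq_abs]
    constructor <;> intro h <;> linarith
  · intro p hp
    rw [Function.mem_support, ite_ne_right_iff] at hp
    have h2 : (2 * n : ℤ) = p.1 ^ 2 + p.2 ^ 2 := by
      have := hp.1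
      zify at this
      simpa only [sq_abs] using this
    have h3 : Even (p.1 + p.2) := by
      have : Even (p.1 ^ 2 + p.2 ^ 2) := ⟨n, by linarith⟩
      simpa [Int.even_add, Int.even_pow] using this
    obtain ⟨u, hu⟩ := h3
    exact ⟨(u, u - p.2), Prod.ext (by simp only [i]; linarith) (by simp only [i]; linarith)⟩

theorem coeff_X_pow_mul_expand {k : ℕ} (hk : k ≠ 0) (f : ℤ⟦X⟧) (i n : ℕ) :
    coeff (k * n + i) (X ^ i * expand k hk f) = coeff n f := by
  rw [coeff_X_pow_mul, coeff_expand_mul]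

theorem coeff_X_pow_mul_expand_of_mod_ne {k : ℕ} (hk : k ≠ 0) (f : ℤ⟦X⟧) {i m : ℕ}
    (h : m % k ≠ i % k) : coeff m (X ^ i * expand k hk f) = 0 := by
  rw [coeff_X_pow_mul']
  split_ifs with hi
  · refine coeff_expand_of_not_dvd _ _ _ fun hd => h ?_
    exact ((Nat.modEq_iff_dvd' hi).2 hd).symm
  · rfl

theorem rescale_neg_one_expand {k : ℕ} (hk : k ≠ 0) (h : Even k) (f : ℤ⟦X⟧) :
    rescale (-1) (expand k hk f) = expand k hk f := by
  ext n
  rw [coeff_rescale, coeff_expand]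
  split_ifs with hn
  · rw [(h.trans_dvd hn).neg_one_pow, one_mul]
  · rw [mul_zero]

theorem exists_bisection (f : ℤ⟦X⟧) : ∃ g, f = expand 2 two_ne_zero (mk fun n => coeff (2 * n) f) +
    X * expand 2 two_ne_zero g := by
  refine ⟨mk fun n => coeff (2 * n + 1) f, ?_⟩
  rw [← pow_one (X : ℤ⟦X⟧)]
  ext n
  rw [map_add]
  obtain ⟨m, rfl | rfl⟩ := Nat.even_or_odd' n
  · rw [coeff_expand_mul, coeff_X_pow_mul_expand_of_mod_ne _ _ (by omega), coeff_mk, add_zero]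
  · rw [coeff_X_pow_mul_expand, coeff_expand_of_not_dvd _ _ _ (by omega), coeff_mk, zero_add]

theorem expand_four (f : ℤ⟦X⟧) :
    expand 4 four_ne_zero f = expand 2 two_ne_zero (expand 2 two_ne_zero f) :=
  expand_mul 2 two_ne_zero 2 two_ne_zero f

theorem expand_eight (f : ℤ⟦X⟧) :
    expand 8 (by norm_num) f = expand 4 four_ne_zero (expand 2 two_ne_zero f) :=
  expand_mul 4 four_ne_zero 2 two_ne_zero f

/-- Squaring φ(q) = φ(q⁴) + 2qψ(q⁸) makes the even part of φ² visible, and r_2(2n) = r_2(n) says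
that this even part is φ² at q². -/
theorem theta_sq_eq : theta 1 ^ 2 = expand 2 two_ne_zero (theta 1) ^ 2 +
    4 * X * expand 4 four_ne_zero psi ^ 2 := by
  have h : theta 1 ^ 2 = expand 2 two_ne_zero (expand 2 two_ne_zero (theta 1) ^ 2 +
      4 * X * expand 4 four_ne_zero psi ^ 2) +
      X ^ 1 * expand 2 two_ne_zero
        (4 * expand 2 two_ne_zero (theta 1) * expand 4 four_ne_zero psi) := by
    conv_lhs => rw [theta_eq]
    simp only [expand_eight, expand_four, map_add, map_mul, map_pow, expand_X, map_ofNat]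
    ring
  ext n
  rw [← coeff_two_mul_theta_sq, h, map_add, coeff_expand_mul,
    coeff_X_pow_mul_expand_of_mod_ne _ _ (by omega), add_zero]

theorem theta_neg_eq : theta (-1) = expand 4 four_ne_zero (theta 1) -
    2 * (X * expand 8 (by norm_num) psi) := by
  rw [← rescale_theta]
  conv_lhs => rw [theta_eq]
  simp only [map_add, map_mul, rescale_neg_one_expand _ (show Even 4 by decide),
    rescale_neg_one_expand _ (show Even 8 by decide), rescale_neg_one_X, map_ofNat]
  ring

theorem theta_neg_sq_eq : theta (-1) ^ 2 = expand 2 two_ne_zero (theta 1) ^ 2 -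
    4 * X * expand 4 four_ne_zero psi ^ 2 := by
  rw [← rescale_theta, ← map_pow]
  conv_lhs => rw [theta_sq_eq]
  simp only [map_add, map_mul, map_pow, rescale_neg_one_expand _ (show Even 4 by decide),
    rescale_neg_one_expand _ (show Even 2 by decide), rescale_neg_one_X, map_ofNat]
  ring

theorem theta_mul_theta_neg :
    theta 1 * theta (-1) = expand 2 two_ne_zero (theta (-1)) ^ 2 := by
  rw [← map_pow, theta_neg_sq_eq]
  simp only [map_sub, map_mul, map_pow, expand_X, map_ofNat, ← expand_four]
  have h1 := theta_eq
  have h2 := theta_neg_eq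
  have h3 : expand 2 two_ne_zero (expand 4 four_ne_zero psi) = expand 8 (by norm_num) psi :=
    (expand_mul 2 two_ne_zero 4 four_ne_zero psi).symm
  rw [h3]
  linear_combination theta (-1) * h1 +
    (expand 4 four_ne_zero (theta 1) + 2 * (X * expand 8 (by norm_num) psi)) * h2

theorem constantCoeff_theta : constantCoeff (theta 1) = 1 := by
  have h : constantCoeff squareSeries = 1 := by
    rw [← coeff_zero_eq_constantCoeff_apply, squareSeries, coeff_mk, if_pos ⟨0, rfl⟩]
  rw [theta_one_eq, map_sub, map_mul, h, map_ofNat, map_one]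
  norm_num

theorem constantCoeff_theta_neg : constantCoeff (theta (-1)) = 1 := by
  rw [← rescale_theta, ← coeff_zero_eq_constantCoeff_apply, coeff_rescale,
    coeff_zero_eq_constantCoeff_apply, constantCoeff_theta]
  simp

theorem ne_zero_of_constantCoeff {f : ℤ⟦X⟧} (h : constantCoeff f = 1) : f ≠ 0 := by
  rintro rfl
  simp at h

/-! ### Theta quotients for v_0(2n) and v_0(4n) -/

theorem v0_two_mul_mul_theta :
    (mk (fun n => 2 * v0 (2 * n)) - 1) * expand 2 two_ne_zero (theta (-1)) = theta 1 ^ 2 := by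
  have h1 := eulerSum_mul_v0_even
  have h2 := eulerSum_mul_theta
  have h3 := theta_mul_theta_neg
  have hne : expand 2 two_ne_zero (theta (-1)) ≠ 0 :=
    ne_zero_of_constantCoeff (by rw [constantCoeff_expand, constantCoeff_theta_neg])
  apply mul_left_cancel₀ (mul_ne_zero (eulerSum_zero_ne_zero (-1)) hne)
  linear_combination theta 1 * theta (-1) * h1 + theta 1 ^ 2 * h2 -
    eulerSum (-1) 0 * (mk (fun n => 2 * v0 (2 * n)) - 1) * h3

/-- `(2 ∑ v_0(4n) q^n - 1) φ(-q) = φ(q)²`. -/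
theorem v0_four_mul_mul_theta :
    (mk (fun n => 2 * v0 (4 * n)) - 1) * theta (-1) = theta 1 ^ 2 := by
  obtain ⟨g, hg⟩ := exists_bisection (mk fun n => 2 * v0 (2 * n))
  have h := v0_two_mul_mul_theta
  have e : (mk fun n => coeff (2 * n) (mk fun n => 2 * v0 (2 * n))) =
      (mk fun n => 2 * v0 (4 * n) : ℤ⟦X⟧) := by
    ext n
    rw [coeff_mk, coeff_mk, coeff_mk, ← mul_assoc 2 2 n]
    norm_num
  rw [e] at hg
  -- The factor φ(-q²) is even in q, so it passes through the bisection; the odd part `g` is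
  -- discarded.
  have h2 : theta 1 ^ 2 = expand 2 two_ne_zero ((mk (fun n => 2 * v0 (4 * n)) - 1) * theta (-1)) +
      X ^ 1 * expand 2 two_ne_zero (g * theta (-1)) := by
    rw [← h, hg]
    simp only [map_mul, map_sub, map_one]
    ring
  ext n
  rw [← coeff_two_mul_theta_sq, h2, map_add, coeff_expand_mul,
    coeff_X_pow_mul_expand_of_mod_ne _ _ (by omega), add_zero]

/-! ### The functions x, t and the parameter y = 2 `modParam` -/

/-- `1 / φ(q)`. -/
noncomputable def thetaInv : ℤ⟦X⟧ := invOfUnit (theta 1) 1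

theorem theta_mul_thetaInv : theta 1 * thetaInv = 1 :=
  mul_invOfUnit _ _ (by simp [constantCoeff_theta])

theorem theta_neg_mul_rescale_thetaInv : theta (-1) * rescale (-1) thetaInv = 1 := by
  rw [← rescale_theta, ← map_mul, theta_mul_thetaInv, map_one]

/-- `φ(q)⁴ / φ(-q)⁴`. -/
noncomputable def thetaRatio : ℤ⟦X⟧ := theta 1 ^ 4 * rescale (-1) thetaInv ^ 4

/-- `φ(-q)⁴ / φ(q)⁴`. -/
noncomputable def thetaRatioInv : ℤ⟦X⟧ := thetaInv ^ 4 * theta (-1) ^ 4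

/-- `ψ(q²) / φ(q)`. -/
noncomputable def psiQuot : ℤ⟦X⟧ := expand 2 two_ne_zero psi * thetaInv

/-- `q ψ(q⁸) / φ(q⁴)`. -/
noncomputable def modParam : ℤ⟦X⟧ := X * expand 4 four_ne_zero psiQuot

theorem thetaRatio_mul_inv : thetaRatio * thetaRatioInv = 1 := by
  unfold thetaRatio thetaRatioInv
  have h1 := theta_mul_thetaInv
  have h2 := theta_neg_mul_rescale_thetaInv
  calc _ = (theta 1 * thetaInv) ^ 4 * (theta (-1) * rescale (-1) thetaInv) ^ 4 := by ring
    _ = 1 := by rw [h1, h2]; ring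

theorem thetaRatio_mul : thetaRatio * theta (-1) ^ 4 = theta 1 ^ 4 := by
  unfold thetaRatio
  have h2 := theta_neg_mul_rescale_thetaInv
  calc _ = theta 1 ^ 4 * (theta (-1) * rescale (-1) thetaInv) ^ 4 := by ring
    _ = _ := by rw [h2]; ring

theorem rescale_thetaRatio : rescale (-1) thetaRatio = thetaRatioInv := by
  unfold thetaRatio thetaRatioInv
  rw [map_mul, map_pow, map_pow, rescale_theta, rescale_rescale]
  simp [mul_comm]

theorem expand_theta_mul_modParam : expand 4 four_ne_zero (theta 1) * modParam =
    X * expand 8 (by norm_num) psi := by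
  have h := congrArg (expand 4 four_ne_zero) theta_mul_thetaInv
  rw [map_mul, map_one] at h
  unfold modParam psiQuot
  rw [expand_eight, map_mul]
  linear_combination X * expand 4 four_ne_zero (expand 2 two_ne_zero psi) * h

theorem theta_eq_modParam :
    theta 1 = expand 4 four_ne_zero (theta 1) * (1 + 2 * modParam) := by
  linear_combination theta_eq - 2 * expand_theta_mul_modParam

theorem theta_neg_eq_modParam :
    theta (-1) = expand 4 four_ne_zero (theta 1) * (1 - 2 * modParam) := by
  linear_combination theta_neg_eq + 2 * expand_theta_mul_modParam

theorem expand_theta_ne_zero : expand 4 four_ne_zero (theta 1) ≠ 0 :=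
  ne_zero_of_constantCoeff (by rw [constantCoeff_expand, constantCoeff_theta])

/-- This is Jacobi's φ(q)⁴ - φ(-q)⁴ = 16qψ(q²)⁴ at q⁴, divided by φ(q⁴)⁴. It makes y a root of a
quartic over series in q⁴. -/
theorem one_sub_modParam_pow :
    1 - 16 * modParam ^ 4 = expand 4 four_ne_zero thetaRatioInv := by
  have h1 := congrArg (expand 2 two_ne_zero) theta_neg_sq_eq
  have h2 := congrArg (expand 2 two_ne_zero) theta_sq_eq
  have h3 : expand 2 two_ne_zero (expand 4 four_ne_zero psi) = expand 8 (by norm_num) psi :=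
    (expand_mul 2 two_ne_zero 4 four_ne_zero psi).symm
  have h4 := congrArg (expand 4 four_ne_zero) thetaRatio_mul
  have h5 := congrArg (expand 4 four_ne_zero) thetaRatio_mul_inv
  have h7 := congrArg (expand 2 two_ne_zero) theta_mul_theta_neg
  simp only [map_sub, map_add, map_mul, map_pow, map_one, map_ofNat, expand_X, h3,
    ← expand_four] at h1 h2 h4 h5 h7
  have hE := expand_theta_mul_modParam
  set A := expand 4 four_ne_zero (theta 1)
  set K := expand 4 four_ne_zero (theta (-1))
  set P := expand 2 two_ne_zero (theta 1)
  set Q := expand 2 two_ne_zero (theta (-1))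
  set p := expand 8 (by norm_num) psi
  apply mul_left_cancel₀ (pow_ne_zero 4 expand_theta_ne_zero)
  have h8 : A ^ 4 * (1 - 16 * modParam ^ 4) = K ^ 4 := by
    linear_combination (P * Q + K ^ 2) * h7 - Q ^ 2 * h2 - (A ^ 2 + 4 * X ^ 2 * p ^ 2) * h1 -
      16 * ((A * modParam) ^ 2 + (X * p) ^ 2) * (A * modParam + X * p) * hE
  linear_combination h8 + expand 4 four_ne_zero thetaRatioInv * h4 - K ^ 4 * h5

theorem thetaRatio_mul_one_sub : thetaRatio * (1 - 2 * modParam) ^ 4 = (1 + 2 * modParam) ^ 4 := by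
  apply mul_left_cancel₀ (pow_ne_zero 4 expand_theta_ne_zero)
  have h := thetaRatio_mul
  rw [theta_neg_eq_modParam] at h
  conv_rhs at h => rw [theta_eq_modParam]
  linear_combination h

theorem one_sub_mul_expand_thetaRatio : (1 - 2 * modParam) * (1 + 2 * modParam) *
    (1 + (2 * modParam) ^ 2) * expand 4 four_ne_zero thetaRatio = 1 := by
  have h := one_sub_modParam_pow
  have h5 := congrArg (expand 4 four_ne_zero) thetaRatio_mul_inv
  rw [map_mul, map_one] at h5
  linear_combination expand 4 four_ne_zero thetaRatio * h + h5

/-- The denominator of x = ((1+y)/(1-y))⁴ is removed by (1-y)(1+y)(1+y²) x(q⁴) = 1, which leaves a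
polynomial in y and x(q⁴). -/
theorem thetaRatio_eq : thetaRatio = (1 + 2 * modParam) ^ 8 * (1 + (2 * modParam) ^ 2) ^ 4 *
    expand 4 four_ne_zero thetaRatio ^ 4 := by
  have h := congrArg (· ^ 4) one_sub_mul_expand_thetaRatio
  have h2 := thetaRatio_mul_one_sub
  linear_combination -thetaRatio * h + (1 + 2 * modParam) ^ 4 * (1 + (2 * modParam) ^ 2) ^ 4 *
    expand 4 four_ne_zero thetaRatio ^ 4 * h2

theorem thetaRatioInv_eq : thetaRatioInv = (1 - 2 * modParam) ^ 8 * (1 + (2 * modParam) ^ 2) ^ 4 *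
    expand 4 four_ne_zero thetaRatio ^ 4 := by
  have h := congrArg (· ^ 4) one_sub_mul_expand_thetaRatio
  have h2 := thetaRatio_mul_one_sub
  have h3 := thetaRatio_mul_inv
  linear_combination -thetaRatioInv * h - (1 - 2 * modParam) ^ 4 * (1 + (2 * modParam) ^ 2) ^ 4 *
    expand 4 four_ne_zero thetaRatio ^ 4 * (thetaRatioInv * h2 - (1 - 2 * modParam) ^ 4 * h3)

/-- `(φ(q)⁴ / φ(-q)⁴ - 1) / 16`. -/
noncomputable def hauptmodul : ℤ⟦X⟧ := modParam * (1 + (2 * modParam) ^ 2) ^ 5 *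
  (1 + 2 * modParam) ^ 4 * expand 4 four_ne_zero thetaRatio ^ 4

/-- The 16 comes from (1+y)⁴ - (1-y)⁴ = 8y(1+y²) with y = 2 `modParam`. -/
theorem thetaRatio_eq_hauptmodul : thetaRatio = 1 + 16 * hauptmodul := by
  have h := congrArg (· ^ 4) one_sub_mul_expand_thetaRatio
  have h2 := thetaRatio_eq
  unfold hauptmodul
  linear_combination h2 + h

theorem sixteen_ne_zero : (16 : ℤ⟦X⟧) ≠ 0 := fun h => by
  have := congrArg constantCoeff h
  rw [map_ofNat, map_zero] at this
  norm_num at this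

theorem modParam_pow_four : modParam ^ 4 =
    expand 4 four_ne_zero (hauptmodul * thetaRatioInv) := by
  have h := one_sub_modParam_pow
  have h2 := congrArg (expand 4 four_ne_zero) thetaRatio_mul_inv
  rw [thetaRatio_eq_hauptmodul] at h2
  simp only [map_mul, map_add, map_one, map_ofNat] at h2
  apply mul_left_cancel₀ sixteen_ne_zero
  rw [map_mul]
  linear_combination -h - h2

/-! ### Fourfold dissection over ℤ[x, x⁻¹] -/

/-- The ring `ℤ[x, x⁻¹]` with `x = φ(q)⁴ / φ(-q)⁴`. -/
noncomputable def ratioRing : Subalgebra ℤ ℤ⟦X⟧ := Algebra.adjoin ℤ {thetaRatio, thetaRatioInv}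

theorem thetaRatio_mem : thetaRatio ∈ ratioRing := Algebra.subset_adjoin (by simp)

theorem thetaRatioInv_mem : thetaRatioInv ∈ ratioRing := Algebra.subset_adjoin (by simp)

/-- The ring of the series `∑_{i<4} y^i a_i(q⁴)` with `y = 2qψ(q⁸)/φ(q⁴)` and `a_i ∈ ℤ[x, x⁻¹]`. -/
noncomputable def dissectRing : Subalgebra ℤ ℤ⟦X⟧ where
  carrier := {f | ∃ a ∈ ratioRing, ∃ b ∈ ratioRing, ∃ c ∈ ratioRing, ∃ d ∈ ratioRing,
    f = expand 4 four_ne_zero a + 2 * modParam * expand 4 four_ne_zero b +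
      (2 * modParam) ^ 2 * expand 4 four_ne_zero c + (2 * modParam) ^ 3 * expand 4 four_ne_zero d}
  add_mem' := by
    rintro _ _ ⟨a, ha, b, hb, c, hc, d, hd, rfl⟩ ⟨a', ha', b', hb', c', hc', d', hd', rfl⟩
    refine ⟨a + a', add_mem ha ha', b + b', add_mem hb hb', c + c', add_mem hc hc',
      d + d', add_mem hd hd', ?_⟩
    simp only [map_add]
    ring
  mul_mem' := by
    rintro _ _ ⟨a, ha, b, hb, c, hc, d, hd, rfl⟩ ⟨a', ha', b', hb', c', hc', d', hd', rfl⟩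
    -- Powers y⁴ and higher are reduced by y⁴ = 1 - 1/x(q⁴), whose right side again lies in the
    -- coefficient ring.
    have hw : 1 - thetaRatioInv ∈ ratioRing := sub_mem (one_mem _) thetaRatioInv_mem
    have h := one_sub_modParam_pow
    refine ⟨a * a' + (1 - thetaRatioInv) * (b * d' + c * c' + d * b'), ?_,
      a * b' + b * a' + (1 - thetaRatioInv) * (c * d' + d * c'), ?_,
      a * c' + b * b' + c * a' + (1 - thetaRatioInv) * (d * d'), ?_,
      a * d' + b * c' + c * b' + d * a', ?_, ?_⟩
    · exact add_mem (mul_mem ha ha') (mul_mem hw (add_mem (add_mem (mul_mem hb hd')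
        (mul_mem hc hc')) (mul_mem hd hb')))
    · exact add_mem (add_mem (mul_mem ha hb') (mul_mem hb ha')) (mul_mem hw
        (add_mem (mul_mem hc hd') (mul_mem hd hc')))
    · exact add_mem (add_mem (add_mem (mul_mem ha hc') (mul_mem hb hb')) (mul_mem hc ha'))
        (mul_mem hw (mul_mem hd hd'))
    · exact add_mem (add_mem (add_mem (mul_mem ha hd') (mul_mem hb hc')) (mul_mem hc hb'))
        (mul_mem hd ha')
    · simp only [map_add, map_mul, map_sub, map_one, ← h]
      ring
  algebraMap_mem' r := by
    refine ⟨algebraMap ℤ _ r, algebraMap_mem _ r, 0, zero_mem _, 0, zero_mem _, 0, zero_mem _, ?_⟩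
    simp only [map_zero, mul_zero, add_zero]
    exact (AlgHom.commutes (expand 4 four_ne_zero) r).symm

theorem expand_mem_dissectRing {a : ℤ⟦X⟧} (ha : a ∈ ratioRing) :
    expand 4 four_ne_zero a ∈ dissectRing :=
  ⟨a, ha, 0, zero_mem _, 0, zero_mem _, 0, zero_mem _, by simp⟩

theorem two_mul_modParam_mem : 2 * modParam ∈ dissectRing :=
  ⟨0, zero_mem _, 1, one_mem _, 0, zero_mem _, 0, zero_mem _, by simp⟩

theorem ratioRing_le_dissectRing : ratioRing ≤ dissectRing := by
  have hy := two_mul_modParam_mem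
  have hx := expand_mem_dissectRing thetaRatio_mem
  have h1 : 1 + (2 * modParam) ^ 2 ∈ dissectRing := add_mem (one_mem _) (pow_mem hy 2)
  refine Algebra.adjoin_le ?_
  rintro _ (rfl | rfl)
  · rw [thetaRatio_eq]
    exact mul_mem (mul_mem (pow_mem (add_mem (one_mem _) hy) _) (pow_mem h1 _)) (pow_mem hx _)
  · rw [thetaRatioInv_eq]
    exact mul_mem (mul_mem (pow_mem (sub_mem (one_mem _) hy) _) (pow_mem h1 _)) (pow_mem hx _)

/-- The fourfold dissection of `φ t g` for `g ∈ ℤ[x, x⁻¹]`. -/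
theorem exists_dissection {g : ℤ⟦X⟧} (hg : g ∈ ratioRing) :
    ∃ a ∈ ratioRing, ∃ d ∈ ratioRing, ∃ u v : ℤ⟦X⟧, theta 1 * (hauptmodul * g) =
      X ^ 0 * expand 4 four_ne_zero (8 * (theta 1 * (hauptmodul * d))) +
      X ^ 1 * expand 4 four_ne_zero (expand 2 two_ne_zero psi * a) +
      X ^ 2 * expand 4 four_ne_zero u + X ^ 3 * expand 4 four_ne_zero v := by
  have hy := two_mul_modParam_mem
  have hx := expand_mem_dissectRing thetaRatio_mem
  have h1 : 1 + (2 * modParam) ^ 2 ∈ dissectRing := add_mem (one_mem _) (pow_mem hy 2)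
  -- This is φ·t·g divided by φ(q⁴)·`modParam`: four of the factors 1 + y come from t and the fifth
  -- from φ.
  have h : (1 + 2 * modParam) ^ 5 * (1 + (2 * modParam) ^ 2) ^ 5 *
      expand 4 four_ne_zero thetaRatio ^ 4 * g ∈ dissectRing :=
    mul_mem (mul_mem (mul_mem (pow_mem (add_mem (one_mem _) hy) _) (pow_mem h1 _)) (pow_mem hx _))
      (ratioRing_le_dissectRing hg)
  obtain ⟨a, ha, b, hb, c, hc, d, hd, h⟩ := h
  refine ⟨a, ha, thetaRatioInv * d, mul_mem thetaRatioInv_mem hd,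
    2 * theta 1 * psiQuot ^ 2 * b, 4 * theta 1 * psiQuot ^ 3 * c, ?_⟩
  have h2 := congrArg (expand 4 four_ne_zero) theta_mul_thetaInv
  have h3 := modParam_pow_four
  have h4 : theta 1 * (hauptmodul * g) = expand 4 four_ne_zero (theta 1) * (modParam *
      ((1 + 2 * modParam) ^ 5 * (1 + (2 * modParam) ^ 2) ^ 5 *
      expand 4 four_ne_zero thetaRatio ^ 4 * g)) := by
    conv_lhs => rw [theta_eq_modParam]
    unfold hauptmodul
    ring
  have h5 : modParam = X * expand 4 four_ne_zero psiQuot := rfl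
  have h6 : expand 4 four_ne_zero (expand 2 two_ne_zero psi) =
      expand 4 four_ne_zero (theta 1) * expand 4 four_ne_zero psiQuot := by
    rw [psiQuot, map_mul]
    rw [map_mul, map_one] at h2
    linear_combination (-expand 4 four_ne_zero (expand 2 two_ne_zero psi)) * h2
  rw [h4, h]
  -- The y³ term meets the extra `modParam` and gives 8 `modParam`⁴ = 8 (t/x)(q⁴). This is the gain
  -- of 2³, and it explains the witness x⁻¹d.
  have h7 : modParam * (expand 4 four_ne_zero a + 2 * modParam * expand 4 four_ne_zero b +
      (2 * modParam) ^ 2 * expand 4 four_ne_zero c + (2 * modParam) ^ 3 * expand 4 four_ne_zero d)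
      = 8 * expand 4 four_ne_zero (hauptmodul * thetaRatioInv) * expand 4 four_ne_zero d +
      modParam * expand 4 four_ne_zero a + 2 * modParam ^ 2 * expand 4 four_ne_zero b +
      4 * modParam ^ 3 * expand 4 four_ne_zero c := by
    linear_combination 8 * expand 4 four_ne_zero d * h3
  rw [h7, h5]
  simp only [map_mul, map_pow, map_ofNat, h6]
  ring

theorem coeff_four_mul_dissection (a b c d : ℤ⟦X⟧) (n : ℕ) :
    coeff (4 * n) (X ^ 0 * expand 4 four_ne_zero a + X ^ 1 * expand 4 four_ne_zero b +
      X ^ 2 * expand 4 four_ne_zero c + X ^ 3 * expand 4 four_ne_zero d) = coeff n a := by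
  have := coeff_X_pow_mul_expand four_ne_zero a 0 n
  rw [add_zero] at this
  rw [map_add, map_add, map_add, this]
  rw [coeff_X_pow_mul_expand_of_mod_ne _ _ (by omega),
    coeff_X_pow_mul_expand_of_mod_ne _ _ (by omega),
    coeff_X_pow_mul_expand_of_mod_ne _ _ (by omega)]
  simp

theorem coeff_four_mul_add_one_dissection (a b c d : ℤ⟦X⟧) (n : ℕ) :
    coeff (4 * n + 1) (X ^ 0 * expand 4 four_ne_zero a + X ^ 1 * expand 4 four_ne_zero b +
      X ^ 2 * expand 4 four_ne_zero c + X ^ 3 * expand 4 four_ne_zero d) = coeff n b := by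
  rw [map_add, map_add, map_add, coeff_X_pow_mul_expand]
  rw [coeff_X_pow_mul_expand_of_mod_ne _ _ (by omega),
    coeff_X_pow_mul_expand_of_mod_ne _ _ (by omega),
    coeff_X_pow_mul_expand_of_mod_ne _ _ (by omega)]
  simp

/-! ### Elements of ℤ[x, x⁻¹] modulo 128 -/

/-- The series congruent to a constant modulo `16`, the even part even modulo `128`. -/
def nearConst : Subalgebra ℤ ℤ⟦X⟧ where
  carrier := {f | ∃ (c : ℤ) (o e : ℤ⟦X⟧), rescale (-1) o = -o ∧ f = C c + 16 * o + 128 * e}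
  add_mem' := by
    rintro _ _ ⟨c, o, e, ho, rfl⟩ ⟨c', o', e', ho', rfl⟩
    refine ⟨c + c', o + o', e + e', by rw [map_add, ho, ho']; ring, ?_⟩
    rw [map_add]
    ring
  mul_mem' := by
    rintro _ _ ⟨c, o, e, ho, rfl⟩ ⟨c', o', e', ho', rfl⟩
    refine ⟨c * c', C c * o' + C c' * o, 2 * o * o' + C c * e' + C c' * e + 16 * o * e' +
      16 * o' * e + 128 * e * e', ?_, ?_⟩
    · simp only [map_add, map_mul, ho, ho']
      have (z : ℤ) : rescale (-1) (C z : ℤ⟦X⟧) = C z := by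
        simp
      rw [this, this]
      ring
    · rw [map_mul]
      ring
  algebraMap_mem' r := ⟨r, 0, 0, by simp, by simp⟩

theorem rescale_hauptmodul : rescale (-1) hauptmodul = -hauptmodul * thetaRatioInv := by
  have h := congrArg (rescale (-1)) thetaRatio_eq_hauptmodul
  rw [rescale_thetaRatio] at h
  simp only [map_add, map_mul, map_one, map_ofNat] at h
  have h2 := thetaRatio_mul_inv
  rw [thetaRatio_eq_hauptmodul] at h2
  apply mul_left_cancel₀ sixteen_ne_zero
  linear_combination -h + h2

theorem rescale_thetaRatioInv : rescale (-1) thetaRatioInv = thetaRatio := by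
  rw [← rescale_thetaRatio, rescale_rescale]
  simp

/-- Replacing q by -q inverts x and sends t to -t/x, so t - 8t²/x is odd. Hence x = 1 + 16t is 1
plus 16 times an odd series plus 128t²/x, and q ↦ -q gives the same shape for x⁻¹. -/
theorem ratioRing_le_nearConst : ratioRing ≤ nearConst := by
  have h1 := thetaRatio_eq_hauptmodul
  have h2 := thetaRatio_mul_inv
  have h3 := rescale_thetaRatioInv
  have h4 := rescale_hauptmodul
  rw [h1] at h2
  have ho : rescale (-1) (hauptmodul - 8 * hauptmodul ^ 2 * thetaRatioInv) =
      -(hauptmodul - 8 * hauptmodul ^ 2 * thetaRatioInv) := by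
    simp only [map_sub, map_mul, map_pow, map_ofNat, h3, h4, h1]
    linear_combination (-hauptmodul - 8 * hauptmodul ^ 2 * thetaRatioInv) * h2
  have hx : thetaRatio = C 1 + 16 * (hauptmodul - 8 * hauptmodul ^ 2 * thetaRatioInv) +
      128 * (hauptmodul ^ 2 * thetaRatioInv) := by
    rw [h1, map_one]
    ring
  refine Algebra.adjoin_le ?_
  rintro _ (rfl | rfl)
  · exact ⟨1, _, _, ho, hx⟩
  · refine ⟨1, -(hauptmodul - 8 * hauptmodul ^ 2 * thetaRatioInv),
      rescale (-1) (hauptmodul ^ 2 * thetaRatioInv), ?_, ?_⟩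
    · rw [map_neg, ho]
    · have h := congrArg (rescale (-1)) hx
      rw [rescale_thetaRatio, map_add, map_add, map_mul, ho, map_mul _ 128] at h
      simp only [map_one, map_ofNat] at h ⊢
      exact h

theorem coeff_even_of_odd {f : ℤ⟦X⟧} (h : rescale (-1) f = -f) (n : ℕ) : coeff (2 * n) f = 0 := by
  have := congrArg (coeff (2 * n)) h
  rw [coeff_rescale, pow_mul, map_neg] at this
  simp only [neg_one_sq, one_pow, one_mul] at this
  omega

/-- The coefficients of `ψ(q²) g(q)`, `g ∈ ℤ[x, x⁻¹]`, at `2n` with `n` not triangular. -/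
theorem dvd_coeff_psi_mul {g : ℤ⟦X⟧} (hg : g ∈ ratioRing) {n : ℕ} (hn : coeff n psi = 0) :
    128 ∣ coeff (2 * n) (expand 2 two_ne_zero psi * g) := by
  obtain ⟨c, o, e, ho, rfl⟩ := ratioRing_le_nearConst hg
  refine ⟨coeff (2 * n) (expand 2 two_ne_zero psi * e), ?_⟩
  have h1 : expand 2 two_ne_zero psi * (C c + 16 * o + 128 * e) =
      C c * expand 2 two_ne_zero psi + (expand 2 two_ne_zero psi * (16 * o) +
        C 128 * (expand 2 two_ne_zero psi * e)) := by
    rw [show (C 128 : ℤ⟦X⟧) = 128 from map_ofNat C 128]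
    ring
  -- The constant contributes a multiple of the n-th coefficient of ψ, which is 0; the odd part
  -- times the even series ψ(q²) has no even exponents.
  rw [h1, map_add, map_add, coeff_C_mul, coeff_C_mul, coeff_expand_mul, hn, coeff_even_of_odd]
  · ring
  · rw [map_mul, map_mul, rescale_neg_one_expand _ even_two, ho, map_ofNat]
    ring

theorem expand_psi_eq : expand 4 four_ne_zero (expand 2 two_ne_zero psi) =
    expand 4 four_ne_zero (theta 1) * expand 4 four_ne_zero psiQuot := by
  rw [← map_mul, psiQuot]
  congr 1
  linear_combination (-expand 2 two_ne_zero psi) * theta_mul_thetaInv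

theorem theta_dissection : theta 1 = X ^ 0 * expand 4 four_ne_zero (theta 1) +
    X ^ 1 * expand 4 four_ne_zero (2 * expand 2 two_ne_zero psi) +
    X ^ 2 * expand 4 four_ne_zero 0 + X ^ 3 * expand 4 four_ne_zero 0 := by
  conv_lhs => rw [theta_eq, expand_eight]
  simp only [map_mul, map_ofNat, map_zero]
  ring

/-! ### Iteration in α and the divisibility -/

/-- The fourfold dissection of `2 ∑ v_0(4n) q^n - 1`. -/
theorem v0_four_mul_dissection : ∃ u v : ℤ⟦X⟧, mk (fun n => 2 * v0 (4 * n)) - 1 =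
    X ^ 0 * expand 4 four_ne_zero (theta 1 + 64 * (theta 1 * (hauptmodul * 1))) +
    X ^ 1 * expand 4 four_ne_zero (8 * (expand 2 two_ne_zero psi * thetaRatio) -
      2 * expand 2 two_ne_zero psi) +
    X ^ 2 * expand 4 four_ne_zero u + X ^ 3 * expand 4 four_ne_zero v := by
  refine ⟨16 * theta 1 * psiQuot ^ 2 * thetaRatio, 32 * theta 1 * psiQuot ^ 3 * thetaRatio, ?_⟩
  have h := v0_four_mul_mul_theta
  have h1 := theta_eq_modParam
  have h2 := theta_neg_eq_modParam
  have h3 := one_sub_mul_expand_thetaRatio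
  have h5 := congrArg (expand 4 four_ne_zero) thetaRatio_mul_inv
  have h7 := congrArg (expand 4 four_ne_zero) thetaRatio_eq_hauptmodul
  rw [map_mul, map_one] at h5
  simp only [map_add, map_mul, map_ofNat, map_one] at h7
  set A := expand 4 four_ne_zero (theta 1) with hA
  set x := expand 4 four_ne_zero thetaRatio with hx
  set H : ℤ⟦X⟧ := mk (fun n => 2 * v0 (4 * n)) - 1
  have h6 : modParam = X * expand 4 four_ne_zero psiQuot := rfl
  rw [h2] at h
  have h8 : H * (1 - 2 * modParam) = A * (1 + 2 * modParam) ^ 2 := by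
    apply mul_left_cancel₀ expand_theta_ne_zero
    rw [← hA]
    linear_combination h + (theta 1 + A * (1 + 2 * modParam)) * h1
  have h9 : H = A * x * (1 + 2 * modParam) ^ 3 * (1 + (2 * modParam) ^ 2) := by
    linear_combination -H * h3 + (1 + 2 * modParam) * (1 + (2 * modParam) ^ 2) * x * h8
  -- Expand (1+y)³(1+y²) and reduce with x(q⁴)y⁴ = x(q⁴) - 1. The constant term 4x - 3 equals 1 +
  -- 64t at q⁴, the source of the initial 2⁶.
  have h10 : H = A * (4 * x - 3) + A * (2 * modParam) * (4 * x - 1) +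
      4 * A * x * (2 * modParam) ^ 2 + 4 * A * x * (2 * modParam) ^ 3 := by
    linear_combination h9 - (3 * A + A * (2 * modParam)) * h3
  rw [h10, h6]
  simp only [map_add, map_sub, map_mul, map_pow, map_ofNat, map_one, expand_psi_eq, ← hA, ← hx]
  linear_combination 4 * A * h7

theorem coeff_ofNat_mul (k n : ℕ) [k.AtLeastTwo] (f : ℤ⟦X⟧) :
    coeff n ((OfNat.ofNat k : ℤ⟦X⟧) * f) = OfNat.ofNat k * coeff n f := by
  rw [← map_ofNat (C (R := ℤ)) k, coeff_C_mul]

theorem coeff_four_mul_one (n : ℕ) : coeff (4 * n) (1 : ℤ⟦X⟧) = coeff n 1 := by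
  simp [coeff_one]

theorem coeff_four_mul_theta (n : ℕ) : coeff (4 * n) (theta 1) = coeff n (theta 1) := by
  conv_lhs => rw [theta_dissection]
  exact coeff_four_mul_dissection _ _ _ _ n

/-- Passing from n to 4n leaves the coefficients of φ and of 1 unchanged, while the remaining term
gains a factor 8 by `exists_dissection`. -/
theorem exists_v0_pow_four_mul (α : ℕ) : ∃ g ∈ ratioRing, ∀ n,
    2 * v0 (4 ^ (α + 2) * n) - coeff n (1 : ℤ⟦X⟧) =
      coeff n (theta 1) + 2 ^ (3 * α + 6) * coeff n (theta 1 * (hauptmodul * g)) := by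
  induction α with
  | zero =>
    refine ⟨1, one_mem _, fun n => ?_⟩
    obtain ⟨u, v, h⟩ := v0_four_mul_dissection
    have h2 := congrArg (coeff (4 * n)) h
    rw [coeff_four_mul_dissection, map_add, coeff_ofNat_mul, map_sub, coeff_mk,
      coeff_four_mul_one, ← mul_assoc] at h2
    norm_num at h2 ⊢
    exact h2
  | succ α ih =>
    obtain ⟨g, hg, h⟩ := ih
    obtain ⟨a, -, d, hd, u, v, h2⟩ := exists_dissection hg
    refine ⟨d, hd, fun n => ?_⟩
    have h3 := h (4 * n)
    have h4 : coeff (4 * n) (theta 1 * (hauptmodul * g)) =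
        8 * coeff n (theta 1 * (hauptmodul * d)) := by
      rw [h2, coeff_four_mul_dissection, coeff_ofNat_mul]
    rw [coeff_four_mul_one, coeff_four_mul_theta, h4, ← mul_assoc (4 ^ (α + 2)), ← pow_succ] at h3
    rw [show α + 1 + 2 = α + 2 + 1 by ring, h3]
    ring

theorem coeff_psi_of_not_triangular {n : ℕ} (hn : ¬ ∃ k : ℕ, n = k * (k + 1) / 2) :
    coeff n psi = 0 := by
  classical
  rw [psi, coeff_mk, if_neg hn]

theorem coeff_theta_of_not_triangular {n : ℕ} (hn : ¬ ∃ k : ℕ, n = k * (k + 1) / 2) :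
    coeff (8 * n + 1) (theta 1) = 0 := by
  classical
  rw [theta_one_eq, map_sub, coeff_ofNat_mul, squareSeries, coeff_mk,
    if_neg (mt (exists_triangular_iff n).2 hn), coeff_one, if_neg (by omega)]
  norm_num

theorem v0_pow_four_mul_dvd {n : ℕ} (hn : ¬ ∃ k : ℕ, n = k * (k + 1) / 2) (α : ℕ) :
    (2 : ℤ) ^ (3 * α + 9) ∣ v0 (4 ^ (α + 1) * (8 * n + 1)) := by
  have hpsi := coeff_psi_of_not_triangular hn
  have e : 8 * n + 1 = 4 * (2 * n) + 1 := by ring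
  have h1 : coeff (8 * n + 1) (1 : ℤ⟦X⟧) = 0 := by rw [coeff_one, if_neg (by omega)]
  suffices h : (2 : ℤ) * 2 ^ (3 * α + 9) ∣ 2 * v0 (4 ^ (α + 1) * (8 * n + 1)) from
    (mul_dvd_mul_iff_left two_ne_zero).1 h
  -- The iteration formula starts at 4², so α = 0 is read off the first dissection, where 8·128 =
  -- 2·2⁹. Afterwards 2^{3α+6}·128 = 2·2^{3(α+1)+9}; the extra 2 belongs to 2v_0.
  rcases α with _ | α
  · obtain ⟨u, v, h⟩ := v0_four_mul_dissection
    have h2 := congrArg (coeff (8 * n + 1)) h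
    rw [e, coeff_four_mul_add_one_dissection, map_sub, map_sub, coeff_ofNat_mul, coeff_ofNat_mul,
      coeff_expand_mul, hpsi, ← e, h1, coeff_mk] at h2
    obtain ⟨c, hc⟩ := dvd_coeff_psi_mul thetaRatio_mem hpsi
    rw [hc] at h2
    exact ⟨c, by norm_num at h2 ⊢; linarith⟩
  · obtain ⟨g, hg, h⟩ := exists_v0_pow_four_mul α
    obtain ⟨a, ha, d, hd, u, v, h2⟩ := exists_dissection hg
    have h3 := h (8 * n + 1)
    rw [h1, coeff_theta_of_not_triangular hn, h2, e, coeff_four_mul_add_one_dissection, ← e] at h3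
    obtain ⟨c, hc⟩ := dvd_coeff_psi_mul ha hpsi
    rw [hc] at h3
    refine ⟨c, ?_⟩
    rw [show α + 1 + 1 = α + 2 by ring]
    linear_combination h3

theorem isSquare_of_sq_mul {a b : ℕ} (ha : a ≠ 0) (h : IsSquare (a ^ 2 * b)) : IsSquare b := by
  obtain ⟨r, hr⟩ := h
  rw [← sq] at hr
  obtain ⟨s, rfl⟩ := (Nat.pow_dvd_pow_iff two_ne_zero).1 (Dvd.intro b hr)
  refine ⟨s, ?_⟩
  rw [mul_pow] at hr
  rw [← sq]
  exact Nat.eq_of_mul_eq_mul_left (by positivity) hr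

/-- The factor p^{2β} is an odd square, hence 1 mod 8, so p^{2β}(8n+1) = 8n' + 1. Since n is
triangular exactly when 8n + 1 is a square, n' is not triangular either, and the case without p
applies to n'. -/
theorem mainTheorem4 (n : ℕ) (hn : ¬ ∃ k : ℕ, n = k * (k + 1) / 2)
    (α β p : ℕ) (hp : p.Prime) (hp3 : 3 ≤ p) :
    v0 (2 ^ (2 * α + 2) * p ^ (2 * β) * (8 * n + 1)) ≡ 0 [ZMOD 2 ^ (3 * α + 9)] := by
  have hodd : Odd (p ^ β) := (hp.odd_of_ne_two (by omega)).pow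
  obtain ⟨t, ht⟩ := Nat.eight_dvd_sq_sub_one_of_odd hodd
  have hsq : p ^ (2 * β) = 8 * t + 1 := by
    have : 0 < (p ^ β) ^ 2 := by positivity
    rw [mul_comm 2 β, pow_mul]
    omega
  have e : p ^ (2 * β) * (8 * n + 1) = 8 * (8 * t * n + t + n) + 1 := by
    rw [hsq]; ring
  rw [mul_assoc, e, show 2 ^ (2 * α + 2) = 4 ^ (α + 1) by
    rw [show 2 * α + 2 = 2 * (α + 1) by ring, pow_mul]; norm_num]
  refine Int.modEq_zero_iff_dvd.2 (v0_pow_four_mul_dvd ?_ α)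
  rw [exists_triangular_iff] at hn ⊢
  rw [← e, mul_comm 2 β, pow_mul]
  exact mt (isSquare_of_sq_mul (pow_ne_zero _ hp.ne_zero)) hn
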